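/- For $n\ge 1$, a lazy transposition $T=(a,b,p)$ in the symmetric group $S_n$ (where $a\neq b$ are elements of $\{1,\dots,n\}$ and $p\in[0,1]$) is the random permutation that equals the transposition $(a,b)$ with probability $p$ and the identity with probability $1-p$. Let $U(n)$ be the minimal length $\ell\ge 0$ of a sequence of independent lazy transpositions $T_1,\dots,T_\ell$ in $S_n$ whose composition $T_1\cdots T_\ell$ is uniformly distributed on $S_n$ (such sequences exist for every $n$). Then there is an $\varepsilon>0$ such that $$U(n)\le (1-\varepsilon)\binom n2\qquad\text{for all } n\ge 6.$$ Moreover, $$U(n)\le \frac23\binom n2+O(n\log n),$$ that is, there is an absolute constant $C$ with $U(n)\le \frac23\binom n2+C\,n\log n$ for all $n\ge 1$. -/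

import Mathlib

/-- A lazy transposition `(a, b, p)` in `S_n`: two distinct positions `a ≠ b` and a probability
`p ∈ [0, 1]`. -/
structure LazyTransposition (n : ℕ) where
  a : Fin n
  b : Fin n
  ne : a ≠ b
  p : NNReal
  le_one : p ≤ 1

/-- The law of the random permutation `(a, b, p)`: flip a coin with success probability `p`; the
outcome is the transposition of `a` and `b` on success and the identity otherwise. -/
noncomputable def LazyTransposition.law {n : ℕ} (T : LazyTransposition n) :
    PMF (Equiv.Perm (Fin n)) :=
  (PMF.bernoulli T.p T.le_one).map fun coin => if coin then Equiv.swap T.a T.b else 1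

/-- The law of the composition `T₁ ⋯ T_ℓ` of independent lazy transpositions: sample each factor
independently and multiply the outcomes in the given order. -/
noncomputable def compositionLaw {n : ℕ} : List (LazyTransposition n) → PMF (Equiv.Perm (Fin n))
  | [] => PMF.pure 1
  | T :: Ts => T.law.bind fun σ => (compositionLaw Ts).map fun τ => σ * τ

/-- A transposition shuffle: the composition of the independent lazy transpositions in the
sequence is uniformly distributed over `S_n`. -/
def IsTranspositionShuffle {n : ℕ} (Ts : List (LazyTransposition n)) : Prop :=
  compositionLaw Ts = PMF.uniformOfFintype (Equiv.Perm (Fin n))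

/-- The lengths of all transposition shuffles in `S_n`. -/
def shuffleLengths (n : ℕ) : Set ℕ :=
  {l | ∃ Ts : List (LazyTransposition n), IsTranspositionShuffle Ts ∧ Ts.length = l}

/-- `U n` is the minimal length of a transposition shuffle in `S_n`. -/
noncomputable def U (n : ℕ) : ℕ := sInf (shuffleLengths n)

/-! Composing on the right with a uniform permutation of all points but three leaves only the coset
to be randomised, and the coset is the triple of images of those three points. So `n` points cost a
shuffle of `n - 3` points plus the price of a uniform triple. Placing the three points one at a time
costs about `3n` and gives `n.choose 2` again; a price of `2n + O(log n)` gives about `n ^ 2 / 3`.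

That price comes from doubling (`TripleUniform.exists_double`). In two copies of an `m`-point set, a
random one of three points of the first copy moves to the second with the right probability. The
recursive list scatters the points left in the first copy, `m - 1` lazy transpositions scatter the
other one, and `m` fair flips between the copies symmetrise the law. Hence the price `T` satisfies
`T(2m) ≤ T(m) + 2m + 2`; `TripleUniform.exists_option` handles odd sizes at constant cost.

The asymptotic bound gives a fixed `ε` for large `n`. For the rest, one transposition is saved at `n
= 6` and the saving survives adding points singly. -/

open Equiv

/-- A lazy transposition of an arbitrary type: swap `a` and `b` with probability `p`. -/
structure LazySwap (α : Type*) where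
  a : α
  b : α
  ne : a ≠ b
  p : NNReal
  le_one : p ≤ 1

/-- Transport of a lazy transposition along an embedding. -/
def LazySwap.map {α β : Type*} (e : α ↪ β) (T : LazySwap α) : LazySwap β :=
  ⟨e T.a, e T.b, e.injective.ne T.ne, T.p, T.le_one⟩

/-- Permutations that agree outside the range of `e` differ by a permutation of that range. -/
theorem exists_mul_viaEmbeddingHom {α β : Type*} (e : β ↪ α) (σ ρ : Perm α)
    (h : ∀ x ∉ Set.range e, σ x = ρ x) : ∃ τ, ρ = σ * Perm.viaEmbeddingHom e τ := by
  have hfix : ∀ x ∉ Set.range e, (σ⁻¹ * ρ) x = x := fun x hx => by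
    simp [← h x hx]
  have hmem : ∀ x, x ∈ Set.range e ↔ (σ⁻¹ * ρ) x ∈ Set.range e := by
    intro x
    by_cases hx : x ∈ Set.range e
    · refine iff_of_true hx ?_
      by_contra h'
      have := hfix _ h'
      rw [(σ⁻¹ * ρ).injective this] at h'
      exact h' hx
    · rw [hfix x hx]
  let π : Perm (Set.range e) := (σ⁻¹ * ρ).subtypePerm (fun x => (hmem x).symm)
  refine ⟨(Equiv.ofInjective e e.injective).permCongr.symm π, ?_⟩
  rw [← inv_mul_eq_iff_eq_mul]
  ext x
  rw [Perm.viaEmbeddingHom_apply]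
  by_cases hx : x ∈ Set.range e
  · obtain ⟨y, rfl⟩ := hx
    rw [Perm.viaEmbedding_apply]
    have := congrArg Subtype.val ((Equiv.ofInjective e e.injective).apply_symm_apply
      (π ((Equiv.ofInjective e e.injective) y)))
    rw [Equiv.ofInjective_apply] at this
    exact this.symm
  · rw [Perm.viaEmbedding_apply_of_notMem _ _ _ hx, hfix x hx]

/-! ### Expectations and reduction to cosets -/

section Expectation

variable {α β : Type*} [DecidableEq α] [DecidableEq β]

/-- Expectation of `F` under the composition of independent lazy transpositions. -/
noncomputable def mean : List (LazySwap α) → (Perm α → ℝ) → ℝ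
  | [], F => F 1
  | T :: Ts, F =>
      (1 - T.p) * mean Ts F + T.p * mean Ts (fun τ => F (swap T.a T.b * τ))

theorem mean_add (L : List (LazySwap α)) (F G : Perm α → ℝ) :
    mean L (fun σ => F σ + G σ) = mean L F + mean L G := by
  induction L generalizing F G with
  | nil => rfl
  | cons T L ih => simp only [mean, ih]; ring

theorem mean_mul (L : List (LazySwap α)) (c : ℝ) (F : Perm α → ℝ) :
    mean L (fun σ => c * F σ) = c * mean L F := by
  induction L generalizing F with
  | nil => rfl
  | cons T L ih => simp only [mean, ih]; ring

theorem mean_const (L : List (LazySwap α)) (c : ℝ) : mean L (fun _ => c) = c := by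
  induction L with
  | nil => rfl
  | cons T L ih => simp only [mean, ih]; ring

theorem mean_append (L L' : List (LazySwap α)) (F : Perm α → ℝ) :
    mean (L ++ L') F = mean L (fun σ => mean L' (fun τ => F (σ * τ))) := by
  induction L generalizing F with
  | nil => simp [mean]
  | cons T L ih => simp only [List.cons_append, mean, ih, mul_assoc]

theorem viaEmbeddingHom_swap (e : α ↪ β) (a b : α) :
    Perm.viaEmbeddingHom e (swap a b) = swap (e a) (e b) := by
  ext x
  rw [Perm.viaEmbeddingHom_apply]
  by_cases hx : x ∈ Set.range e
  · obtain ⟨y, rfl⟩ := hx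
    rw [Perm.viaEmbedding_apply, e.injective.map_swap]
  · rw [Perm.viaEmbedding_apply_of_notMem _ _ _ hx, swap_apply_of_ne_of_ne] <;>
      rintro rfl <;> simp at hx

theorem mean_map (e : α ↪ β) (L : List (LazySwap α)) (F : Perm β → ℝ) :
    mean (L.map (LazySwap.map e)) F = mean L (fun τ => F (Perm.viaEmbeddingHom e τ)) := by
  induction L generalizing F with
  | nil => simp [mean]
  | cons T L ih =>
    simp only [List.map_cons, mean, ih, map_mul, viaEmbeddingHom_swap, LazySwap.map]

/-- The composition is a uniformly random permutation. -/
def IsUniform [Fintype α] (L : List (LazySwap α)) : Prop :=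
  ∀ F : Perm α → ℝ, mean L F = (∑ σ, F σ) / Fintype.card (Perm α)

/-- A list that averages correctly over the cosets of the permutations supported on the range of
`e`, followed by a uniform permutation of that range, is uniform. -/
theorem IsUniform.append_map [Fintype α] [Fintype β] {e : β ↪ α} {L : List (LazySwap α)}
    {S : List (LazySwap β)} (hS : IsUniform S)
    (hL : ∀ G : Perm α → ℝ, (∀ σ τ, G (σ * Perm.viaEmbeddingHom e τ) = G σ) →
      mean L G = (∑ σ, G σ) / Fintype.card (Perm α)) :
    IsUniform (L ++ S.map (LazySwap.map e)) := by
  intro F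
  rw [mean_append]
  simp only [mean_map, hS _]
  have hc : (Fintype.card (Perm β) : ℝ) ≠ 0 := by exact_mod_cast Fintype.card_ne_zero
  rw [hL]
  · congr 1
    rw [← Finset.sum_div, Finset.sum_comm]
    have (τ : Perm β) : ∑ σ, F (σ * Perm.viaEmbeddingHom e τ) = ∑ σ, F σ :=
      Equiv.sum_comp (Equiv.mulRight (Perm.viaEmbeddingHom e τ)) F
    simp [this, hc]
  · intro σ τ
    congr 1
    simp only [mul_assoc, ← map_mul]
    exact Equiv.sum_comp (Equiv.mulLeft τ) (fun ρ => F (σ * Perm.viaEmbeddingHom e ρ))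

end Expectation

/-! ### Uniform placement of one point -/

/-- The rightmost factor meets the points first: it sends `x` to the new point `b` with probability
`1 / (s.card + 2)`, and the older factors fix `b`. The last clause carries the induction. -/
theorem exists_spread_finset {α : Type*} [DecidableEq α] (x : α) (s : Finset α) (hx : x ∉ s) :
    ∃ L : List (LazySwap α), L.length = s.card ∧
      (∀ g : α → ℝ, mean L (fun σ => g (σ x)) = (g x + ∑ y ∈ s, g y) / (s.card + 1)) ∧
      ∀ g : α → ℝ, ∀ b ∉ s, b ≠ x → mean L (fun σ => g (σ b)) = g b := by
  induction s using Finset.induction_on with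
  | empty => exact ⟨[], by simp [mean]⟩
  | insert b s hb ih =>
    rw [Finset.mem_insert, not_or] at hx
    obtain ⟨L, hlen, hu, hf⟩ := ih hx.2
    have hq : (1 / (s.card + 2) : NNReal) ≤ 1 := by
      rw [div_le_one (by positivity)]
      exact le_add_left (by norm_num)
    refine ⟨L ++ [⟨x, b, hx.1, 1 / (s.card + 2), hq⟩], by simp [hlen, hb], fun g => ?_,
      fun g c hc hcx => ?_⟩
    · have := hf g b hb (Ne.symm hx.1)
      simp only [mean_append, mean, mul_one, mean_add, mean_mul, Perm.mul_apply,
        swap_apply_left, hu, this, Finset.sum_insert hb, Finset.card_insert_of_notMem hb]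
      push_cast
      field_simp
      ring
    · rw [Finset.mem_insert, not_or] at hc
      simp only [mean_append, mean, mul_one, mean_add, mean_mul, Perm.mul_apply,
        swap_apply_of_ne_of_ne hcx hc.1, hf g c hc.2 hcx]
      ring

section SinglePoint

variable {α β : Type*} [Fintype α] [DecidableEq α] [Fintype β] [DecidableEq β]

/-- A uniformly random image of one point costs one lazy transposition per other point. -/
theorem exists_spread (x : α) :
    ∃ L : List (LazySwap α), L.length = Fintype.card α - 1 ∧
      ∀ g : α → ℝ, mean L (fun σ => g (σ x)) = (∑ y, g y) / Fintype.card α := by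
  obtain ⟨L, hlen, hu, -⟩ := exists_spread_finset x (Finset.univ.erase x) (by simp)
  have hc : ((Finset.univ.erase x).card : ℝ) + 1 = Fintype.card α := by
    exact_mod_cast Finset.card_erase_add_one (Finset.mem_univ x)
  refine ⟨L, by simp [hlen], fun g => ?_⟩
  rw [hu, hc, Finset.add_sum_erase _ _ (Finset.mem_univ x)]

/-- Double counting: right multiplication by `swap x y` shows that the sum over `σ` does not depend
on the point. -/
theorem sum_perm_apply (x : α) (g : α → ℝ) :
    (∑ σ : Perm α, g (σ x)) / Fintype.card (Perm α) = (∑ y, g y) / Fintype.card α := by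
  have h1 : ∑ y, ∑ σ : Perm α, g (σ y) = Fintype.card (Perm α) * ∑ y, g y := by
    rw [Finset.sum_comm]
    simp_rw [Equiv.sum_comp (_ : Perm α) g]
    simp
  have h2 (y : α) : ∑ σ : Perm α, g (σ y) = ∑ σ : Perm α, g (σ x) := by
    rw [← Equiv.sum_comp (Equiv.mulRight (swap x y))]
    simp
  simp_rw [h2] at h1
  have : Nonempty α := ⟨x⟩
  have hc : (Fintype.card (Perm α) : ℝ) ≠ 0 := by exact_mod_cast Fintype.card_ne_zero
  have hc' : (Fintype.card α : ℝ) ≠ 0 := by exact_mod_cast Fintype.card_ne_zero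
  rw [div_eq_div_iff hc hc']
  simp at h1
  linarith

/-- Shuffling one point more than `β` costs `Fintype.card β` more lazy transpositions. -/
theorem IsUniform.exists_succ {e : β ↪ α} {x : α} (hx : (Set.range e)ᶜ = {x})
    {S : List (LazySwap β)} (hS : IsUniform S) :
    ∃ L : List (LazySwap α), L.length = S.length + (Fintype.card α - 1) ∧ IsUniform L := by
  obtain ⟨L, hlen, hL⟩ := exists_spread x
  refine ⟨_, ?_, hS.append_map (e := e) (L := L) fun G hG => ?_⟩
  · simp [hlen, add_comm]
  -- The coset of `σ` is determined by `σ x`, so `swap x (σ x)` represents it.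
  have key (σ : Perm α) : G σ = G (swap x (σ x)) := by
    obtain ⟨τ, hτ⟩ := exists_mul_viaEmbeddingHom e σ (swap x (σ x)) (fun y hy => by
      have : y ∈ (Set.range e)ᶜ := hy
      rw [hx, Set.mem_singleton_iff] at this
      simp [this])
    rw [hτ, hG]
  rw [show G = fun σ => G (swap x (σ x)) from funext key, hL (fun y => G (swap x y)),
    ← sum_perm_apply x (fun y => G (swap x y))]

end SinglePoint

/-! ### Uniform placement of three points -/

theorem exists_perm_triple {α : Type*} {x y z a b c : α} (hxy : x ≠ y) (hxz : x ≠ z) (hyz : y ≠ z)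
    (hab : a ≠ b) (hac : a ≠ c) (hbc : b ≠ c) : ∃ ρ : Perm α, ρ x = a ∧ ρ y = b ∧ ρ z = c := by
  have h1 : Function.Injective ![x, y, z] := by
    intro i j; fin_cases i <;> fin_cases j <;> simp_all [eq_comm]
  have h2 : Function.Injective ![a, b, c] := by
    intro i j; fin_cases i <;> fin_cases j <;> simp_all [eq_comm]
  obtain ⟨ρ, hρ⟩ := Perm.exists_extending_pair ![x, y, z] ![a, b, c] h1 h2
  exact ⟨ρ, by simpa using hρ 0, by simpa using hρ 1, by simpa using hρ 2⟩

section Triples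

variable {α β : Type*}

/-- `f` vanishes on triples with a repeated entry. -/
def OffDiagonal (f : α → α → α → ℝ) : Prop :=
  (∀ a b, f a a b = 0) ∧ (∀ a b, f a b a = 0) ∧ ∀ a b, f b a a = 0

theorem OffDiagonal.comp {f : β → β → β → ℝ} (hf : OffDiagonal f) (e : α → β) :
    OffDiagonal (fun a b c => f (e a) (e b) (e c)) :=
  ⟨fun _ _ => hf.1 _ _, fun _ _ => hf.2.1 _ _, fun _ _ => hf.2.2 _ _⟩

variable [DecidableEq α] [DecidableEq β]

/-- The expected value of `f` at the images of three points. -/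
noncomputable def tripleMean (L : List (LazySwap α)) (f : α → α → α → ℝ) (x y z : α) : ℝ :=
  mean L (fun σ => f (σ x) (σ y) (σ z))

theorem tripleMean_nil (f : α → α → α → ℝ) : tripleMean [] f = f := rfl

/-- The leftmost factor acts last on points, hence is averaged first into `f`. -/
theorem tripleMean_append (L L' : List (LazySwap α)) (f : α → α → α → ℝ) :
    tripleMean (L ++ L') f = tripleMean L' (tripleMean L f) := by
  induction L generalizing f with
  | nil => rfl
  | cons T L ih =>
    funext x y z
    have h1 := congrFun (congrFun (congrFun (ih f) x) y) z
    have h2 := congrFun (congrFun (congrFun (ih fun a b c =>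
      f (swap T.a T.b a) (swap T.a T.b b) (swap T.a T.b c)) x) y) z
    simp only [tripleMean] at h1 h2
    simp only [tripleMean, List.cons_append, mean, Perm.mul_apply, h1, h2, mean_add, mean_mul]

theorem tripleMean_cons (T : LazySwap α) (L : List (LazySwap α)) (f : α → α → α → ℝ) :
    tripleMean (T :: L) f = tripleMean L (tripleMean [T] f) :=
  tripleMean_append [T] L f

theorem tripleMean_singleton (T : LazySwap α) (f : α → α → α → ℝ) (x y z : α) :
    tripleMean [T] f x y z = (1 - T.p) * f x y z +
      T.p * f (swap T.a T.b x) (swap T.a T.b y) (swap T.a T.b z) := by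
  simp [tripleMean, mean]

theorem tripleMean_map (e : α ↪ β) (L : List (LazySwap α)) (f : β → β → β → ℝ) (x y z : α) :
    tripleMean (L.map (LazySwap.map e)) f (e x) (e y) (e z) =
      tripleMean L (fun a b c => f (e a) (e b) (e c)) x y z := by
  simp only [tripleMean, mean_map, Perm.viaEmbeddingHom_apply, Perm.viaEmbedding_apply]

theorem OffDiagonal.tripleMean {f : α → α → α → ℝ} (hf : OffDiagonal f)
    (L : List (LazySwap α)) : OffDiagonal (tripleMean L f) := by
  refine ⟨fun a b => ?_, fun a b => ?_, fun a b => ?_⟩ <;>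
    simp only [_root_.tripleMean, hf.1, hf.2.1, hf.2.2, mean_const]

/-- A lazy transposition preserves the sum over all triples. -/
theorem sum_tripleMean [Fintype α] (L : List (LazySwap α)) (f : α → α → α → ℝ) :
    ∑ x, ∑ y, ∑ z, tripleMean L f x y z = ∑ x, ∑ y, ∑ z, f x y z := by
  induction L generalizing f with
  | nil => rfl
  | cons T L ih =>
    rw [tripleMean_cons, ih]
    simp only [tripleMean_singleton, Finset.sum_add_distrib, ← Finset.mul_sum]
    have : ∑ x, ∑ y, ∑ z, f (swap T.a T.b x) (swap T.a T.b y) (swap T.a T.b z) =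
        ∑ x, ∑ y, ∑ z, f x y z := by
      rw [← Equiv.sum_comp (swap T.a T.b) (fun x => ∑ y, ∑ z, f x y z)]
      refine Finset.sum_congr rfl fun x _ => ?_
      rw [← Equiv.sum_comp (swap T.a T.b) (fun y => ∑ z, f _ y z)]
      refine Finset.sum_congr rfl fun y _ => ?_
      rw [← Equiv.sum_comp (swap T.a T.b) (fun z => f _ _ z)]
    rw [this]
    ring

/-- The images of `x`, `y`, `z` form a uniformly random triple of distinct points. -/
def TripleUniform [Fintype α] (L : List (LazySwap α)) (x y z : α) : Prop :=
  ∀ f : α → α → α → ℝ, OffDiagonal f → tripleMean L f x y z =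
    (∑ a, ∑ b, ∑ c, f a b c) /
      (Fintype.card α * (Fintype.card α - 1) * (Fintype.card α - 2))

variable [Fintype α] [Fintype β]

theorem TripleUniform.swap_left {L : List (LazySwap α)} {x y z : α} (h : TripleUniform L x y z) :
    TripleUniform L y x z := by
  intro f hf
  rw [Finset.sum_comm]
  exact h (fun a b c => f b a c) ⟨hf.1, fun a b => hf.2.2 _ _, fun a b => hf.2.1 _ _⟩

theorem TripleUniform.swap_right {L : List (LazySwap α)} {x y z : α}
    (h : TripleUniform L x y z) : TripleUniform L x z y := by
  intro f hf
  have : ∑ a, ∑ b, ∑ c, f a b c = ∑ a, ∑ b, ∑ c, f a c b :=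
    Finset.sum_congr rfl fun a _ => Finset.sum_comm
  rw [this]
  exact h (fun a b c => f a c b) ⟨hf.2.1, hf.1, hf.2.2⟩

theorem TripleUniform.map {L : List (LazySwap α)} {x y z : α} (h : TripleUniform L x y z)
    (e : α ≃ β) : TripleUniform (L.map (LazySwap.map e.toEmbedding)) (e x) (e y) (e z) := by
  intro f hf
  have := tripleMean_map e.toEmbedding L f x y z
  simp only [Equiv.coe_toEmbedding] at this
  rw [this, h _ (hf.comp e), Fintype.card_congr e]
  congr 1
  rw [← Equiv.sum_comp e]
  refine Finset.sum_congr rfl fun a _ => ?_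
  rw [← Equiv.sum_comp e]
  refine Finset.sum_congr rfl fun b _ => ?_
  rw [← Equiv.sum_comp e]

theorem sum_distinct_triples (S : ℝ) :
    ∑ a : α, ∑ b : α, ∑ c : α, (if a ≠ b ∧ a ≠ c ∧ b ≠ c then S else 0) =
      Fintype.card α * (Fintype.card α - 1) * (Fintype.card α - 2) * S := by
  have h3 (a b : α) (hab : a ≠ b) :
      ∑ c : α, (if a ≠ c ∧ b ≠ c then S else 0) = (Fintype.card α - 2) * S := by
    have hc : (({a, b} : Finset α).card : ℝ) = 2 := by simp [hab]
    have := Finset.card_compl_add_card ({a, b} : Finset α)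
    have h' : (({a, b} : Finset α)ᶜ.card : ℝ) = Fintype.card α - 2 := by
      rw [← this]; push_cast; rw [hc]; ring
    rw [← h', ← Finset.sum_filter, Finset.sum_const, nsmul_eq_mul]
    congr 3
    ext c
    simp [eq_comm]
  have h2 (a : α) : ∑ b : α, ∑ c : α, (if a ≠ b ∧ a ≠ c ∧ b ≠ c then S else 0) =
      (Fintype.card α - 1) * (Fintype.card α - 2) * S := by
    rw [← Finset.add_sum_erase _ _ (Finset.mem_univ a)]
    have : ∀ b ∈ Finset.univ.erase a, ∑ c : α, (if a ≠ b ∧ a ≠ c ∧ b ≠ c then S else 0) =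
        (Fintype.card α - 2) * S := by
      intro b hb
      have hab : a ≠ b := (Finset.ne_of_mem_erase hb).symm
      rw [← h3 a b hab]
      simp [hab]
    have hc := Finset.card_erase_add_one (Finset.mem_univ a)
    have hc' : ((Finset.univ.erase a).card : ℝ) = Fintype.card α - 1 := by
      rw [← Finset.card_univ, ← hc]; push_cast; ring
    rw [Finset.sum_congr rfl this, Finset.sum_const, nsmul_eq_mul, hc']
    simp
    ring
  simp only [h2, Finset.sum_const, nsmul_eq_mul, Finset.card_univ]
  ring

/-- Double counting again: permutations act transitively on distinct triples, so the sum over `σ` is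
the same for each of them. -/
theorem sum_perm_triple {x y z : α} (hxy : x ≠ y) (hxz : x ≠ z) (hyz : y ≠ z)
    {f : α → α → α → ℝ} (hf : OffDiagonal f) :
    (∑ σ : Perm α, f (σ x) (σ y) (σ z)) / Fintype.card (Perm α) =
      (∑ a, ∑ b, ∑ c, f a b c) /
        (Fintype.card α * (Fintype.card α - 1) * (Fintype.card α - 2)) := by
  have h1 : ∑ a, ∑ b, ∑ c, ∑ σ : Perm α, f (σ a) (σ b) (σ c) =
      Fintype.card (Perm α) * ∑ a, ∑ b, ∑ c, f a b c := by
    have (σ : Perm α) : ∑ a, ∑ b, ∑ c, f (σ a) (σ b) (σ c) = ∑ a, ∑ b, ∑ c, f a b c := by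
      rw [← Equiv.sum_comp σ (fun a => ∑ b, ∑ c, f a b c)]
      refine Finset.sum_congr rfl fun a _ => ?_
      rw [← Equiv.sum_comp σ (fun b => ∑ c, f _ b c)]
      refine Finset.sum_congr rfl fun b _ => ?_
      rw [← Equiv.sum_comp σ (fun c => f _ _ c)]
    calc _ = ∑ a, ∑ b, ∑ σ : Perm α, ∑ c, f (σ a) (σ b) (σ c) := by
          refine Finset.sum_congr rfl fun a _ => Finset.sum_congr rfl fun b _ => Finset.sum_comm
      _ = ∑ a, ∑ σ : Perm α, ∑ b, ∑ c, f (σ a) (σ b) (σ c) := by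
          refine Finset.sum_congr rfl fun a _ => Finset.sum_comm
      _ = ∑ σ : Perm α, ∑ a, ∑ b, ∑ c, f (σ a) (σ b) (σ c) := Finset.sum_comm
      _ = _ := by simp [this]
  obtain ⟨S, hS⟩ : ∃ S, S = ∑ σ : Perm α, f (σ x) (σ y) (σ z) := ⟨_, rfl⟩
  have h2 (a b c : α) : ∑ σ : Perm α, f (σ a) (σ b) (σ c) =
      if a ≠ b ∧ a ≠ c ∧ b ≠ c then S else 0 := by
    split_ifs with h
    · rw [hS]
      obtain ⟨ρ, rfl, rfl, rfl⟩ := exists_perm_triple hxy hxz hyz h.1 h.2.1 h.2.2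
      exact Equiv.sum_comp (Equiv.mulRight ρ) (fun σ : Perm α => f (σ x) (σ y) (σ z))
    · refine Finset.sum_eq_zero fun σ _ => ?_
      by_cases hab : a = b
      · rw [hab]; exact hf.1 _ _
      by_cases hac : a = c
      · rw [hac]; exact hf.2.1 _ _
      by_cases hbc : b = c
      · rw [hbc]; exact hf.2.2 _ _
      exact absurd ⟨hab, hac, hbc⟩ h
  simp_rw [h2, sum_distinct_triples] at h1
  have hcard : ({x, y, z} : Finset α).card = 3 := Finset.card_eq_three.2 ⟨x, y, z, hxy, hxz, hyz, rfl⟩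
  have h3 : (3 : ℝ) ≤ Fintype.card α := by
    exact_mod_cast hcard ▸ Finset.card_le_univ _
  have hc : (Fintype.card (Perm α) : ℝ) ≠ 0 := by exact_mod_cast Fintype.card_ne_zero
  have hp : (0 : ℝ) < Fintype.card α * (Fintype.card α - 1) * (Fintype.card α - 2) :=
    mul_pos (mul_pos (by linarith) (by linarith)) (by linarith)
  rw [div_eq_div_iff hc hp.ne', ← hS]
  linarith

theorem IsUniform.tripleUniform {L : List (LazySwap α)} (hL : IsUniform L) {x y z : α}
    (hxy : x ≠ y) (hxz : x ≠ z) (hyz : y ≠ z) : TripleUniform L x y z := by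
  intro f hf
  rw [tripleMean, hL, sum_perm_triple hxy hxz hyz hf]

/-- Shuffling after placing three points uniformly. -/
theorem IsUniform.append_tripleUniform {e : β ↪ α} {x y z : α} (hxy : x ≠ y) (hxz : x ≠ z)
    (hyz : y ≠ z) (hx : (Set.range e)ᶜ = {x, y, z}) {S : List (LazySwap β)} (hS : IsUniform S)
    {L : List (LazySwap α)} (hL : TripleUniform L x y z) :
    IsUniform (L ++ S.map (LazySwap.map e)) := by
  classical
  refine hS.append_map fun G hG => ?_
  -- `G` depends only on the three images. The default `0` makes `g` vanish on triples with a
  -- repeated entry.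
  let g : α → α → α → ℝ := fun a b c =>
    if h : ∃ σ : Perm α, σ x = a ∧ σ y = b ∧ σ z = c then G h.choose else 0
  have hg : OffDiagonal g := by
    refine ⟨fun a b => dif_neg ?_, fun a b => dif_neg ?_, fun a b => dif_neg ?_⟩ <;>
      rintro ⟨σ, h1, h2, h3⟩
    · exact hxy (σ.injective (h1.trans h2.symm))
    · exact hxz (σ.injective (h1.trans h3.symm))
    · exact hyz (σ.injective (h2.trans h3.symm))
  have key : G = fun σ => g (σ x) (σ y) (σ z) := by
    funext σ
    have h : ∃ ρ : Perm α, ρ x = σ x ∧ ρ y = σ y ∧ ρ z = σ z := ⟨σ, rfl, rfl, rfl⟩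
    have hs := h.choose_spec
    obtain ⟨τ, hτ⟩ := exists_mul_viaEmbeddingHom e σ h.choose (fun w hw => by
      have : w ∈ (Set.range e)ᶜ := hw
      rw [hx] at this
      obtain rfl | rfl | rfl := this
      exacts [hs.1.symm, hs.2.1.symm, hs.2.2.symm])
    simp only [g, dif_pos h]
    rw [hτ, hG]
  have := hL g hg
  rw [tripleMean, ← key] at this
  rw [this, ← sum_perm_triple hxy hxz hyz hg, ← key]

end Triples

/-! ### Pairs, and exchanging one of three points -/

section PairMean

variable {α β : Type*}

theorem viaEmbeddingHom_inl_inl (τ : Perm α) (a : α) :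
    Perm.viaEmbeddingHom (Function.Embedding.inl : α ↪ α ⊕ β) τ (Sum.inl a) = Sum.inl (τ a) :=
  Perm.viaEmbedding_apply _ _ _

theorem viaEmbeddingHom_inl_inr (τ : Perm α) (b : β) :
    Perm.viaEmbeddingHom (Function.Embedding.inl : α ↪ α ⊕ β) τ (Sum.inr b) = Sum.inr b :=
  Perm.viaEmbedding_apply_of_notMem _ _ _ (by simp)

theorem viaEmbeddingHom_inr_inr (τ : Perm β) (b : β) :
    Perm.viaEmbeddingHom (Function.Embedding.inr : β ↪ α ⊕ β) τ (Sum.inr b) = Sum.inr (τ b) :=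
  Perm.viaEmbedding_apply _ _ _

theorem viaEmbeddingHom_inr_inl (τ : Perm β) (a : α) :
    Perm.viaEmbeddingHom (Function.Embedding.inr : β ↪ α ⊕ β) τ (Sum.inl a) = Sum.inl a :=
  Perm.viaEmbedding_apply_of_notMem _ _ _ (by simp)

theorem viaEmbeddingHom_some_some (τ : Perm α) (a : α) :
    Perm.viaEmbeddingHom (Function.Embedding.some : α ↪ Option α) τ (some a) = some (τ a) :=
  Perm.viaEmbedding_apply _ _ _

theorem viaEmbeddingHom_some_none (τ : Perm α) :
    Perm.viaEmbeddingHom (Function.Embedding.some : α ↪ Option α) τ none = none :=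
  Perm.viaEmbedding_apply_of_notMem _ _ _ (by simp)

variable [DecidableEq α]

theorem three_le_card [Fintype α] {x y z : α} (hxy : x ≠ y) (hxz : x ≠ z) (hyz : y ≠ z) :
    3 ≤ Fintype.card α := by
  have : ({x, y, z} : Finset α).card = 3 :=
    Finset.card_eq_three.2 ⟨x, y, z, hxy, hxz, hyz, rfl⟩
  exact this ▸ Finset.card_le_univ _

/-- A pair of distinct points extends to a distinct triple in `Fintype.card α - 2` ways, and this
factor cancels. Needed once one of the three points has left the block. -/
theorem TripleUniform.pair [Fintype α] {L : List (LazySwap α)} {x y z : α}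
    (h : TripleUniform L x y z) (hxy : x ≠ y) (hxz : x ≠ z) (hyz : y ≠ z) {g : α → α → ℝ}
    (hg : ∀ a, g a a = 0) :
    mean L (fun σ => g (σ x) (σ y)) =
      (∑ a, ∑ b, g a b) / (Fintype.card α * (Fintype.card α - 1)) := by
  have h3 : (3 : ℝ) ≤ Fintype.card α := by exact_mod_cast three_le_card hxy hxz hyz
  let f : α → α → α → ℝ := fun a b c => if a ≠ c ∧ b ≠ c then g a b else 0
  have hf : OffDiagonal f := ⟨fun a b => by simp [f, hg], fun a b => by simp [f],
    fun a b => by simp [f]⟩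
  have key : mean L (fun σ => g (σ x) (σ y)) = tripleMean L f x y z := by
    simp [tripleMean, f, hxz, hyz]
  have hsum (a b : α) : ∑ c, f a b c = (Fintype.card α - 2) * g a b := by
    by_cases hab : a = b
    · subst hab
      simp [f, hg]
    have hc : (({a, b} : Finset α).card : ℝ) = 2 := by simp [hab]
    have h' : (({a, b} : Finset α)ᶜ.card : ℝ) = Fintype.card α - 2 := by
      rw [← Finset.card_compl_add_card ({a, b} : Finset α)]; push_cast; rw [hc]; ring
    rw [← h', ← Finset.sum_filter, Finset.sum_const, nsmul_eq_mul]
    congr 3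
    ext c
    simp [eq_comm]
  rw [key, h f hf]
  simp_rw [hsum, ← Finset.mul_sum]
  have : (Fintype.card α : ℝ) - 2 ≠ 0 := by linarith
  rw [mul_comm (_ - 2 : ℝ), mul_div_mul_right _ _ this]

/-- Exchange the point `w` with a uniformly random one of `x`, `y`, `z` with probability `p`. -/
noncomputable def exchange {x y z w : α} (hxz : x ≠ z) (hyz : y ≠ z) (hzw : z ≠ w) (p : NNReal)
    (hp : p ≤ 1) : List (LazySwap α) :=
  [⟨z, w, hzw, p, hp⟩,
    ⟨y, z, hyz, 1 / 3, by rw [div_le_one (by norm_num)]; norm_num⟩,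
    ⟨x, z, hxz, 1 / 2, by rw [div_le_one (by norm_num)]; norm_num⟩]

/-- Read from the right, the coins `1 / 2` and `1 / 3` bring each of the three points to position
`z` with probability `1 / 3`; then `z` is exchanged with `w`. The hypotheses list every arrangement
that occurs, since `f` need not be symmetric. -/
theorem tripleMean_exchange {x y z w : α} (hxz : x ≠ z) (hyz : y ≠ z) (hzw : z ≠ w) {p : NNReal}
    (hp : p ≤ 1) (hxy : x ≠ y) (hxw : x ≠ w) (hyw : y ≠ w) {f : α → α → α → ℝ} {d e₁ e₂ e₃ : ℝ}
    (h₀ : f x y z = d) (h₀₁ : f z y x = d) (h₀₂ : f x z y = d) (h₀₃ : f y z x = d)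
    (h₁ : f w y x = e₁) (h₂ : f x w y = e₂) (h₂' : f y w x = e₂) (h₃ : f x y w = e₃) :
    tripleMean (exchange hxz hyz hzw p hp) f x y z =
      (1 - p) * d + p * ((e₁ + e₂ + e₃) / 3) := by
  rw [exchange, tripleMean_cons, tripleMean_cons]
  simp [tripleMean_singleton, swap_apply_of_ne_of_ne, hxz, hyz, hxy, hxw, hyw,
    hxy.symm, h₀, h₀₁, h₀₂, h₀₃, h₁, h₂, h₂', h₃]
  ring

end PairMean

/-! ### Adding one point -/

section Extension

variable {α : Type*} [Fintype α] [DecidableEq α]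

/-- The exchange probability `3 / (Fintype.card α + 1)` is the chance that a uniform triple in
`Option α` contains `none`. -/
theorem TripleUniform.exists_option {L : List (LazySwap α)} {x y z : α}
    (h : TripleUniform L x y z) (hxy : x ≠ y) (hxz : x ≠ z) (hyz : y ≠ z) :
    ∃ L' : List (LazySwap (Option α)), L'.length = L.length + 3 ∧
      TripleUniform L' (some x) (some y) (some z) := by
  have h3 : (3 : ℝ) ≤ Fintype.card α := by exact_mod_cast three_le_card hxy hxz hyz
  have hp : (3 / (Fintype.card α + 1) : NNReal) ≤ 1 := by
    rw [div_le_one (by positivity)]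
    have : (3 : NNReal) ≤ Fintype.card α := by exact_mod_cast three_le_card hxy hxz hyz
    exact this.trans (by simp)
  refine ⟨L.map (LazySwap.map Function.Embedding.some) ++ exchange (x := some x) (y := some y)
    (z := some z) (w := none) (by simpa) (by simpa) (by simp) _ hp, by simp [exchange],
    fun f hf => ?_⟩
  have hin {x y z : α} (h : TripleUniform L x y z) :
      tripleMean (L.map (LazySwap.map Function.Embedding.some)) f (some x) (some y) (some z) =
        (∑ a, ∑ b, ∑ c, f (some a) (some b) (some c)) /
          (Fintype.card α * (Fintype.card α - 1) * (Fintype.card α - 2)) := by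
    rw [← h _ (hf.comp some)]
    exact tripleMean_map Function.Embedding.some L f x y z
  have h₂ {x y z : α} (h : TripleUniform L x y z) (hxy : x ≠ y) (hxz : x ≠ z) (hyz : y ≠ z) :
      tripleMean (L.map (LazySwap.map Function.Embedding.some)) f (some x) none (some y) =
        (∑ a, ∑ b, f (some a) none (some b)) / (Fintype.card α * (Fintype.card α - 1)) := by
    simp only [tripleMean, mean_map, viaEmbeddingHom_some_some, viaEmbeddingHom_some_none]
    exact h.pair hxy hxz hyz (g := fun a b => f (some a) none (some b)) (fun a => hf.2.1 _ _)
  have h₁ : tripleMean (L.map (LazySwap.map Function.Embedding.some)) f none (some y) (some x) =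
        (∑ a, ∑ b, f none (some a) (some b)) / (Fintype.card α * (Fintype.card α - 1)) := by
    simp only [tripleMean, mean_map, viaEmbeddingHom_some_some, viaEmbeddingHom_some_none]
    exact h.swap_left.pair hxy.symm hyz hxz (g := fun a b => f none (some a) (some b))
      (fun a => hf.2.2 _ _)
  have h₃ : tripleMean (L.map (LazySwap.map Function.Embedding.some)) f (some x) (some y) none =
        (∑ a, ∑ b, f (some a) (some b) none) / (Fintype.card α * (Fintype.card α - 1)) := by
    simp only [tripleMean, mean_map, viaEmbeddingHom_some_some, viaEmbeddingHom_some_none]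
    exact h.pair hxy hxz hyz (g := fun a b => f (some a) (some b) none) (fun a => hf.1 _ _)
  rw [tripleMean_append, tripleMean_exchange _ _ _ hp (by simpa) (by simp) (by simp) (hin h)
    (hin h.swap_left.swap_right.swap_left) (hin h.swap_right) (hin h.swap_left.swap_right)
    h₁ (h₂ h hxy hxz hyz) (h₂ h.swap_left hxy.symm hyz hxz) h₃]
  simp only [Fintype.sum_option, Finset.sum_add_distrib, hf.1, hf.2.1, hf.2.2,
    Finset.sum_const_zero, Fintype.card_option]
  push_cast
  have h4 : (Fintype.card α : ℝ) - 1 ≠ 0 := by linarith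
  have h5 : (Fintype.card α : ℝ) - 2 ≠ 0 := by linarith
  have h6 : (Fintype.card α : ℝ) ≠ 0 := by linarith
  have h7 : (Fintype.card α : ℝ) + 1 ≠ 0 := by linarith
  rw [add_sub_cancel_right, show (Fintype.card α : ℝ) + 1 - 2 = Fintype.card α - 1 by ring]
  field_simp
  ring

end Extension

/-! ### Doubling the number of points -/

section Doubling

variable {β : Type*} [DecidableEq β]

/-- Exchange the two copies of `i` with probability `1 / 2`. -/
noncomputable def fiberFlip (i : β) : LazySwap (β ⊕ β) :=
  ⟨Sum.inl i, Sum.inr i, Sum.inl_ne_inr, 1 / 2, by rw [div_le_one (by norm_num)]; norm_num⟩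

/-- `f` is invariant under exchanging the two copies of any `i ∈ s`. -/
def FlipInvariant (s : Set β) (f : β ⊕ β → β ⊕ β → β ⊕ β → ℝ) : Prop :=
  ∀ i ∈ s, ∀ a b c, f (swap (Sum.inl i) (Sum.inr i) a) (swap (Sum.inl i) (Sum.inr i) b)
    (swap (Sum.inl i) (Sum.inr i) c) = f a b c

theorem swap_fiber_comm (i j : β) (a : β ⊕ β) :
    swap (Sum.inl i) (Sum.inr i) (swap (Sum.inl j) (Sum.inr j) a) =
      swap (Sum.inl j) (Sum.inr j) (swap (Sum.inl i) (Sum.inr i) a) := by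
  by_cases hij : i = j
  · rw [hij]
  · rcases a with a | a <;> simp only [swap_apply_def] <;> grind

/-- A fair flip symmetrises its own fibre and commutes with the other flips, so earlier invariance
survives. -/
theorem FlipInvariant.tripleMean {s : Set β} {f : β ⊕ β → β ⊕ β → β ⊕ β → ℝ}
    (hf : FlipInvariant s f) (j : β) :
    FlipInvariant (insert j s) (tripleMean [fiberFlip j] f) := by
  rintro i (rfl | hi) a b c
  · simp only [tripleMean_singleton, fiberFlip, swap_apply_self]
    push_cast
    ring
  · simp only [tripleMean_singleton, fiberFlip, hf i hi, swap_fiber_comm j i]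

theorem FlipInvariant.tripleMean_list {s : Set β} {f : β ⊕ β → β ⊕ β → β ⊕ β → ℝ}
    (hf : FlipInvariant s f) (l : List β) :
    FlipInvariant ({i | i ∈ l} ∪ s) (_root_.tripleMean (l.map fiberFlip) f) := by
  induction l generalizing s f with
  | nil => simpa [tripleMean_nil] using hf
  | cons j l ih =>
    rw [List.map_cons, tripleMean_cons]
    convert ih (hf.tripleMean j) using 1
    ext i
    simp only [List.mem_cons, Set.mem_union, Set.mem_ofPred_eq, Set.mem_insert_iff]
    tauto

variable {f : β ⊕ β → β ⊕ β → β ⊕ β → ℝ}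

/-- Exchanging the two copies is the product of all fibre flips; the induction exchanges one fibre
at a time. -/
theorem FlipInvariant.swap [Fintype β] (hf : FlipInvariant Set.univ f) (a b c : β ⊕ β) :
    f a.swap b.swap c.swap = f a b c := by
  have key (s : Finset β) : ∀ F : β ⊕ β → β ⊕ β,
      (∀ a, F a = if a.elim id id ∈ s then a.swap else a) → f (F a) (F b) (F c) = f a b c := by
    induction s using Finset.induction_on with
    | empty => intro F hF; simp [hF]
    | insert i s hi ih =>
      intro F hF
      have (a : β ⊕ β) : F a = Equiv.swap (Sum.inl i) (Sum.inr i)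
          (if a.elim id id ∈ s then a.swap else a) := by
        rw [hF]
        rcases a with a | a <;> by_cases h : a = i <;> by_cases h' : a ∈ s <;>
          simp_all [swap_apply_of_ne_of_ne]
      rw [this a, this b, this c, hf i (Set.mem_univ i)]
      exact ih (fun a => if a.elim id id ∈ s then a.swap else a) (fun _ => rfl)
  exact key Finset.univ Sum.swap (by simp)

/-- The sum of `f` over triples with the last point, only, in the second copy. -/
def lastInrSum [Fintype β] (f : β ⊕ β → β ⊕ β → β ⊕ β → ℝ) : ℝ :=
  ∑ i, ∑ j, ∑ k, f (.inl i) (.inl j) (.inr k)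

/-- Two of three points share a copy, which may be taken to be the first: eight patterns collapse to
four. -/
theorem sum_eq_of_swap_invariant {β : Type*} [Fintype β] {f : β ⊕ β → β ⊕ β → β ⊕ β → ℝ}
    (hf : ∀ a b c : β ⊕ β, f a.swap b.swap c.swap = f a b c) :
    ∑ a, ∑ b, ∑ c, f a b c = 2 * ((∑ i, ∑ j, ∑ k, f (.inl i) (.inl j) (.inl k)) +
      (lastInrSum (fun a b c => f c a b) + lastInrSum (fun a b c => f a c b) +
        lastInrSum f)) := by
  have h1 (i j k : β) : f (.inr i) (.inr j) (.inr k) = f (.inl i) (.inl j) (.inl k) :=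
    hf (.inl i) (.inl j) (.inl k)
  have h2 (i j k : β) : f (.inr i) (.inr j) (.inl k) = f (.inl i) (.inl j) (.inr k) :=
    hf (.inl i) (.inl j) (.inr k)
  have h3 (i j k : β) : f (.inr i) (.inl j) (.inr k) = f (.inl i) (.inr j) (.inl k) :=
    hf (.inl i) (.inr j) (.inl k)
  have h4 (i j k : β) : f (.inl i) (.inr j) (.inr k) = f (.inr i) (.inl j) (.inl k) :=
    hf (.inr i) (.inl j) (.inl k)
  have h5 : lastInrSum (fun a b c => f c a b) = ∑ i, ∑ j, ∑ k, f (.inr i) (.inl j) (.inl k) := by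
    rw [Finset.sum_comm]
    exact Finset.sum_congr rfl fun i _ => Finset.sum_comm
  have h6 : lastInrSum (fun a b c => f a c b) = ∑ i, ∑ j, ∑ k, f (.inl i) (.inr j) (.inl k) :=
    Finset.sum_congr rfl fun i _ => Finset.sum_comm
  simp only [Fintype.sum_sum_type, Finset.sum_add_distrib, h1, h2, h3, h4, h5, h6]
  rw [lastInrSum]
  ring

/-- Doubling the number of points costs two lazy transpositions per point, up to a constant. -/
theorem TripleUniform.exists_double [Fintype β] {L : List (LazySwap β)} {x y z : β}
    (h : TripleUniform L x y z) (hxy : x ≠ y) (hxz : x ≠ z) (hyz : y ≠ z) :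
    ∃ L' : List (LazySwap (β ⊕ β)), L'.length = L.length + 2 * Fintype.card β + 2 ∧
      TripleUniform L' (.inl x) (.inl y) (.inl z) := by
  have h3' : 3 ≤ Fintype.card β := three_le_card hxy hxz hyz
  have h3 : (3 : ℝ) ≤ Fintype.card β := by exact_mod_cast h3'
  obtain ⟨S, hSlen, hS⟩ := exists_spread x
  -- With `m = Fintype.card β`, this is `1 - (m - 2) / (2 * (2m - 1))`, the probability that a
  -- uniform triple of distinct points does not lie in one copy.
  obtain ⟨p, hp, hpv⟩ : ∃ p : NNReal, p ≤ 1 ∧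
      (p : ℝ) = 3 * Fintype.card β / (2 * (2 * Fintype.card β - 1)) := by
    refine ⟨(3 * Fintype.card β / (2 * (2 * Fintype.card β - 1)) : ℝ).toNNReal, ?_,
      Real.coe_toNNReal _ (div_nonneg (by linarith) (by linarith))⟩
    rw [Real.toNNReal_le_one, div_le_one (by linarith)]
    linarith
  refine ⟨Finset.univ.toList.map fiberFlip ++ (S.map (LazySwap.map Function.Embedding.inr) ++
    (L.map (LazySwap.map Function.Embedding.inl) ++ exchange (x := Sum.inl x) (y := Sum.inl y)
    (z := Sum.inl z) (w := Sum.inr x) (by simpa) (by simpa) (by simp) p hp)), ?_, fun f hf => ?_⟩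
  · simp only [List.length_append, List.length_map, Finset.length_toList, Finset.card_univ,
      hSlen, exchange, List.length_cons, List.length_nil]
    omega
  rw [tripleMean_append, tripleMean_append, tripleMean_append]
  -- Flips preserve the total over triples, so both sides involve only the symmetrised function.
  rw [← sum_tripleMean (Finset.univ.toList.map fiberFlip) f]
  have hinv : FlipInvariant Set.univ (_root_.tripleMean (Finset.univ.toList.map fiberFlip) f) := by
    have : FlipInvariant ∅ f := fun i hi => hi.elim
    convert this.tripleMean_list Finset.univ.toList
    ext
    simp
  replace hf := hf.tripleMean (Finset.univ.toList.map fiberFlip)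
  generalize _root_.tripleMean (Finset.univ.toList.map fiberFlip) f = g at hf hinv
  rw [sum_eq_of_swap_invariant hinv.swap]
  have h₀ {x y z : β} (h : TripleUniform L x y z) :
      tripleMean (L.map (LazySwap.map Function.Embedding.inl))
        (tripleMean (S.map (LazySwap.map Function.Embedding.inr)) g) (.inl x) (.inl y) (.inl z) =
        (∑ i, ∑ j, ∑ k, g (.inl i) (.inl j) (.inl k)) /
          (Fintype.card β * (Fintype.card β - 1) * (Fintype.card β - 2)) := by
    rw [← h _ (hf.comp Sum.inl)]
    simp only [tripleMean, mean_map, viaEmbeddingHom_inl_inl, viaEmbeddingHom_inr_inl, mean_const]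
  have hsum (F : β → β → β → ℝ) : (∑ a, ∑ b, (∑ c, F a b c) / (Fintype.card β : ℝ)) =
      (∑ a, ∑ b, ∑ c, F a b c) / Fintype.card β := by
    simp only [← Finset.sum_div]
  -- With one point in the second copy, `L` places the other two as a uniform pair and `S` places
  -- that point independently.
  have h₂ {x' y' z' : β} (h : TripleUniform L x' y' z') (hxy : x' ≠ y') (hxz : x' ≠ z')
      (hyz : y' ≠ z') :
      tripleMean (L.map (LazySwap.map Function.Embedding.inl))
        (tripleMean (S.map (LazySwap.map Function.Embedding.inr)) g) (.inl x') (.inr x) (.inl y') =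
        lastInrSum (fun a b c => g a c b) / Fintype.card β /
          (Fintype.card β * (Fintype.card β - 1)) := by
    simp only [tripleMean, mean_map, viaEmbeddingHom_inl_inl, viaEmbeddingHom_inl_inr,
      viaEmbeddingHom_inr_inl, viaEmbeddingHom_inr_inr]
    rw [lastInrSum, ← hsum, ← h.pair hxy hxz hyz]
    · congr 1
      funext σ
      exact hS (fun c => g (.inl (σ x')) (.inr c) (.inl (σ y')))
    · exact fun a => by simp [hf.2.1]
  have h₁ : tripleMean (L.map (LazySwap.map Function.Embedding.inl))
        (tripleMean (S.map (LazySwap.map Function.Embedding.inr)) g) (.inr x) (.inl y) (.inl x) =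
        lastInrSum (fun a b c => g c a b) / Fintype.card β /
          (Fintype.card β * (Fintype.card β - 1)) := by
    simp only [tripleMean, mean_map, viaEmbeddingHom_inl_inl, viaEmbeddingHom_inl_inr,
      viaEmbeddingHom_inr_inl, viaEmbeddingHom_inr_inr]
    rw [lastInrSum, ← hsum, ← h.swap_left.pair hxy.symm hyz hxz]
    · congr 1
      funext σ
      exact hS (fun c => g (.inr c) (.inl (σ y)) (.inl (σ x)))
    · exact fun a => by simp [hf.2.2]
  have h₃ : tripleMean (L.map (LazySwap.map Function.Embedding.inl))
        (tripleMean (S.map (LazySwap.map Function.Embedding.inr)) g) (.inl x) (.inl y) (.inr x) =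
        lastInrSum g / Fintype.card β / (Fintype.card β * (Fintype.card β - 1)) := by
    simp only [tripleMean, mean_map, viaEmbeddingHom_inl_inl, viaEmbeddingHom_inl_inr,
      viaEmbeddingHom_inr_inl, viaEmbeddingHom_inr_inr]
    rw [lastInrSum, ← hsum, ← h.pair hxy hxz hyz]
    · congr 1
      funext σ
      exact hS (fun c => g (.inl (σ x)) (.inl (σ y)) (.inr c))
    · exact fun a => by simp [hf.1]
  rw [tripleMean_exchange _ _ _ hp (by simpa) (by simp) (by simp) (h₀ h)
    (h₀ h.swap_left.swap_right.swap_left) (h₀ h.swap_right) (h₀ h.swap_left.swap_right)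
    h₁ (h₂ h hxy hxz hyz) (h₂ h.swap_left hxy.symm hyz hxz) h₃, hpv, Fintype.card_sum]
  push_cast
  rw [show (Fintype.card β + Fintype.card β : ℝ) = 2 * Fintype.card β by ring,
    show (2 * Fintype.card β - 2 : ℝ) = 2 * (Fintype.card β - 1) by ring]
  have h4 : (Fintype.card β : ℝ) - 1 ≠ 0 := by linarith
  have h5 : (Fintype.card β : ℝ) - 2 ≠ 0 := by linarith
  have h6 : (Fintype.card β : ℝ) ≠ 0 := by linarith
  have h7 : 2 * (Fintype.card β : ℝ) - 1 ≠ 0 := by linarith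
  obtain ⟨q, hq⟩ : ∃ q, 2 * (Fintype.card β : ℝ) - 1 = q := ⟨_, rfl⟩
  rw [hq] at h7 ⊢
  field_simp
  rw [← hq]
  ring

end Doubling

/-! ### Lengths of shuffles and the recursions -/

section Lengths

/-- There is a list of `l` lazy transpositions of `Fin n` with uniform composition. -/
def HasShuffle (n l : ℕ) : Prop :=
  ∃ L : List (LazySwap (Fin n)), L.length = l ∧ IsUniform L

/-- There is a list of `l` lazy transpositions of `Fin n` that moves some three points to a
uniformly random triple of distinct points. -/
def HasTripleShuffle (n l : ℕ) : Prop :=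
  ∃ (L : List (LazySwap (Fin n))) (x y z : Fin n), x ≠ y ∧ x ≠ z ∧ y ≠ z ∧ L.length = l ∧
    TripleUniform L x y z

/-- A lazy transposition of `Fin n` as a `LazyTransposition`. -/
def LazySwap.toLazyTransposition {n : ℕ} (T : LazySwap (Fin n)) : LazyTransposition n :=
  ⟨T.a, T.b, T.ne, T.p, T.le_one⟩

theorem map_mul_left_apply {n : ℕ} (q : PMF (Perm (Fin n))) (s σ : Perm (Fin n)) :
    q.map (fun τ => s * τ) σ = q (s⁻¹ * σ) := by
  rw [PMF.map_apply]
  simp only [← inv_mul_eq_iff_eq_mul]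
  simp only [eq_comm, tsum_ite_eq]

theorem compositionLaw_cons_apply {n : ℕ} (T : LazyTransposition n)
    (Ts : List (LazyTransposition n)) (σ : Perm (Fin n)) :
    compositionLaw (T :: Ts) σ = (1 - T.p) * compositionLaw Ts σ +
      T.p * compositionLaw Ts (swap T.a T.b * σ) := by
  rw [compositionLaw, LazyTransposition.law, PMF.bind_map, PMF.bind_apply, tsum_bool]
  have h : (swap T.a T.b)⁻¹ = swap T.a T.b := swap_inv _ _
  simp only [Function.comp_apply, map_mul_left_apply, PMF.bernoulli_apply, Bool.false_eq_true,
    if_true, if_false, h]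
  simp

/-- Testing `mean` on indicators recovers the law, so `IsUniform` yields an equality of `PMF`s. -/
theorem toReal_compositionLaw {n : ℕ} (L : List (LazySwap (Fin n))) (σ : Perm (Fin n)) :
    (compositionLaw (L.map LazySwap.toLazyTransposition) σ).toReal =
      mean L (fun τ => if τ = σ then 1 else 0) := by
  induction L generalizing σ with
  | nil =>
    simp only [List.map_nil, compositionLaw, PMF.pure_apply, mean, eq_comm (a := σ)]
    split_ifs <;> simp
  | cons T L ih =>
    rw [List.map_cons, compositionLaw_cons_apply, ENNReal.toReal_add, ENNReal.toReal_mul,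
      ENNReal.toReal_mul, ih, ih, mean]
    · have h (τ : Perm (Fin n)) : τ = swap T.a T.b * σ ↔ swap T.a T.b * τ = σ := by
        rw [← inv_mul_eq_iff_eq_mul, swap_inv]
      simp only [LazySwap.toLazyTransposition, h]
      rw [ENNReal.toReal_sub_of_le (by exact_mod_cast T.le_one) (by simp)]
      simp
    · exact ENNReal.mul_ne_top (by simp) (PMF.apply_ne_top _ _)
    · exact ENNReal.mul_ne_top (by simp) (PMF.apply_ne_top _ _)

theorem HasShuffle.mem {n l : ℕ} (h : HasShuffle n l) : l ∈ shuffleLengths n := by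
  obtain ⟨L, hl, hL⟩ := h
  refine ⟨L.map LazySwap.toLazyTransposition, ?_, by simpa⟩
  refine PMF.ext fun σ => ?_
  rw [← ENNReal.toReal_eq_toReal_iff' (PMF.apply_ne_top _ _) (PMF.apply_ne_top _ _),
    toReal_compositionLaw, hL]
  simp

theorem HasShuffle.le {n l : ℕ} (h : HasShuffle n l) : U n ≤ l := Nat.sInf_le h.mem

theorem HasShuffle.succ {n l : ℕ} (h : HasShuffle n l) : HasShuffle (n + 1) (l + n) := by
  obtain ⟨L, rfl, hL⟩ := h
  obtain ⟨L', hl, hL'⟩ := hL.exists_succ (e := Fin.succEmb n) (x := 0) (by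
    rw [Fin.coe_succEmb, Fin.range_succ, compl_compl])
  exact ⟨L', by simpa using hl, hL'⟩

theorem hasShuffle_choose (n : ℕ) : HasShuffle n (n.choose 2) := by
  induction n with
  | zero => exact ⟨[], rfl, fun F => by simp [mean, Subsingleton.elim _ (1 : Perm (Fin 0))]⟩
  | succ n ih =>
    rw [Nat.choose_succ_succ' n 1, Nat.choose_one_right, Nat.add_comm n (n.choose 2)]
    exact ih.succ

theorem TripleUniform.hasTripleShuffle {α : Type*} [Fintype α] [DecidableEq α]
    {L : List (LazySwap α)} {x y z : α} (h : TripleUniform L x y z) (hxy : x ≠ y) (hxz : x ≠ z)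
    (hyz : y ≠ z) : HasTripleShuffle (Fintype.card α) L.length :=
  let e := Fintype.equivFin α
  ⟨_, _, _, _, e.injective.ne hxy, e.injective.ne hxz, e.injective.ne hyz, by simp, h.map e⟩

theorem hasTripleShuffle_three : HasTripleShuffle 3 3 := by
  obtain ⟨L, hl, hL⟩ := hasShuffle_choose 3
  exact ⟨L, 0, 1, 2, by decide, by decide, by decide, hl,
    hL.tripleUniform (by decide) (by decide) (by decide)⟩

theorem HasTripleShuffle.succ {n l : ℕ} (h : HasTripleShuffle n l) :
    HasTripleShuffle (n + 1) (l + 3) := by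
  obtain ⟨L, x, y, z, hxy, hxz, hyz, rfl, hL⟩ := h
  obtain ⟨L', hl, hL'⟩ := hL.exists_option hxy hxz hyz
  simpa [hl] using hL'.hasTripleShuffle (by simpa) (by simpa) (by simpa)

theorem HasTripleShuffle.double {n l : ℕ} (h : HasTripleShuffle n l) :
    HasTripleShuffle (2 * n) (l + 2 * n + 2) := by
  obtain ⟨L, x, y, z, hxy, hxz, hyz, rfl, hL⟩ := h
  obtain ⟨L', hl, hL'⟩ := hL.exists_double hxy hxz hyz
  have := hL'.hasTripleShuffle (by simpa) (by simpa) (by simpa)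
  rwa [hl, Fintype.card_sum, Fintype.card_fin, ← two_mul] at this

theorem HasShuffle.add_three {n l t : ℕ} (h : HasShuffle n l) (ht : HasTripleShuffle (n + 3) t) :
    HasShuffle (n + 3) (t + l) := by
  obtain ⟨S, rfl, hS⟩ := h
  obtain ⟨L, x, y, z, hxy, hxz, hyz, rfl, hL⟩ := ht
  have hc : Fintype.card {w : Fin (n + 3) // w ∉ ({x, y, z} : Finset (Fin (n + 3)))} = n := by
    have : ({x, y, z} : Finset (Fin (n + 3))).card = 3 :=
      Finset.card_eq_three.2 ⟨x, y, z, hxy, hxz, hyz, rfl⟩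
    rw [Fintype.card_subtype_compl, Fintype.card_coe, this, Fintype.card_fin, Nat.add_sub_cancel]
  let e : Fin n ↪ Fin (n + 3) :=
    (Fintype.equivFinOfCardEq hc).symm.toEmbedding.trans (Function.Embedding.subtype _)
  refine ⟨_, ?_, hS.append_tripleUniform (e := e) hxy hxz hyz ?_ hL⟩
  · simp
  · ext w
    simp only [e, Function.Embedding.coe_trans, Set.mem_compl_iff, Set.range_comp,
      Equiv.coe_toEmbedding, Equiv.range_eq_univ, Set.image_univ]
    simp
    tauto

/-- The doubling costs sum geometrically to `2 * n`; each halving adds at most `5`, namely `2` for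
the doubling and `3` for an odd point. -/
theorem exists_hasTripleShuffle (n : ℕ) (hn : 3 ≤ n) :
    ∃ l ≤ 2 * n + 5 * Nat.log 2 n, HasTripleShuffle n l := by
  induction n using Nat.strong_induction_on with
  | _ n ih =>
    by_cases h6 : n < 6
    · have h3 := hasTripleShuffle_three
      have h1 : 1 ≤ Nat.log 2 n := Nat.log_pos (by norm_num) (by omega)
      interval_cases n
      · exact ⟨3, by omega, h3⟩
      · exact ⟨6, by omega, h3.succ⟩
      · exact ⟨9, by omega, h3.succ.succ⟩
    · obtain ⟨l, hl, h⟩ := ih (n / 2) (by omega) (by omega)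
      have hlog : Nat.log 2 n = Nat.log 2 (n / 2) + 1 := Nat.log_of_one_lt_of_le (by norm_num) (by omega)
      rcases Nat.even_or_odd' n with ⟨m, rfl | rfl⟩
      · rw [show 2 * m / 2 = m by omega] at h hl hlog
        exact ⟨_, by omega, h.double⟩
      · rw [show (2 * m + 1) / 2 = m by omega] at h hl hlog
        exact ⟨_, by omega, h.double.succ⟩

/-- Going from `n` to `n + 3` points, three times the `2 * (n + 3)` of the triple exceeds the growth
of `n ^ 2` by `9`, which three new summands `3 + 5 * Nat.log 2 (n + 3)` pay along with the
logarithm. -/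
theorem exists_hasShuffle (n : ℕ) :
    ∃ l, 3 * l ≤ n ^ 2 + n * (3 + 5 * Nat.log 2 n) ∧ HasShuffle n l := by
  induction n using Nat.strong_induction_on with
  | _ n ih =>
    by_cases h3 : n < 3
    · refine ⟨_, ?_, hasShuffle_choose n⟩
      interval_cases n
      · simp
      · simp
      · simp; omega
    · obtain ⟨n, rfl⟩ := Nat.exists_eq_add_of_le' (not_lt.1 h3)
      obtain ⟨l, hl, h⟩ := ih n (by omega)
      obtain ⟨t, ht, h'⟩ := exists_hasTripleShuffle (n + 3) (by omega)
      refine ⟨_, ?_, h.add_three h'⟩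
      have hlog : Nat.log 2 n ≤ Nat.log 2 (n + 3) := Nat.log_mono_right (by omega)
      have := Nat.mul_le_mul_left n hlog
      nlinarith

/-- At `n = 6` the doubled triple costs `3 + 6 + 2 = 11` and the other three points cost `3`,
against `15`. Each further point costs exactly the increment of `n.choose 2`. -/
theorem exists_hasShuffle_lt_choose (n : ℕ) (hn : 6 ≤ n) :
    ∃ l, l + 1 ≤ n.choose 2 ∧ HasShuffle n l := by
  induction n, hn using Nat.le_induction with
  | base => exact ⟨14, by decide,
      (hasShuffle_choose 3).add_three hasTripleShuffle_three.double⟩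
  | succ n hn ih =>
    obtain ⟨l, hl, h⟩ := ih
    refine ⟨_, ?_, h.succ⟩
    have : (n + 1).choose 2 = n + n.choose 2 := by
      rw [Nat.choose_succ_succ' n 1, Nat.choose_one_right]
    omega

theorem U_le_log (n : ℕ) (hn : 1 ≤ n) :
    (U n : ℝ) ≤ 2 / 3 * (n.choose 2 : ℝ) + 6 * ((n : ℝ) * Real.log (n : ℝ)) := by
  -- As `log 1 = 0`, the bound at `n = 1` requires `U 1 = 0`.
  obtain rfl | h2 := hn.eq_or_lt
  · have : U 1 = 0 := Nat.le_zero.1 (hasShuffle_choose 1).le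
    simp [this]
  obtain ⟨l, hl, h⟩ := exists_hasShuffle n
  have hU : (U n : ℝ) ≤ l := by exact_mod_cast h.le
  have hl' : (3 * l : ℝ) ≤ n ^ 2 + n * (3 + 5 * Nat.log 2 n) := by exact_mod_cast hl
  have hn0 : (2 : ℝ) ≤ n := by exact_mod_cast h2
  have hlog2 := Real.log_two_gt_d9
  have h1 : (1 : ℝ) ≤ 2 * Real.log n := by
    have := Real.log_le_log (by norm_num) hn0
    linarith
  have h3 : (Nat.log 2 n : ℝ) ≤ 2 * Real.log n := by
    have h4 : (Nat.log 2 n : ℝ) * Real.log 2 ≤ Real.log n := by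
      rw [← Real.log_pow]
      refine Real.log_le_log (by positivity) ?_
      exact_mod_cast Nat.pow_log_le_self 2 (by omega)
    have : (0 : ℝ) ≤ Nat.log 2 n := by positivity
    nlinarith
  rw [Nat.cast_choose_two]
  -- The excess is `4n/3 + (5n/3) * Nat.log 2 n`; by `h1` and `h3` it is at most `(8/3 + 10/3) * n *
  -- log n`.
  nlinarith

theorem exists_U_le_one_sub_mul_choose : ∃ ε : ℝ, 0 < ε ∧ ∀ n : ℕ, 6 ≤ n →
    (U n : ℝ) ≤ (1 - ε) * (n.choose 2 : ℝ) := by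
  -- This is when `6 * n * log n` is at most `1/6` of `n.choose 2`, raising `2/3` to `5/6`.
  have hev : ∀ᶠ n : ℕ in Filter.atTop, 72 * Real.log n ≤ n - 1 := by
    have h1 := (Real.isLittleO_log_id_atTop.comp_tendsto tendsto_natCast_atTop_atTop).def
      (show (0 : ℝ) < 1 / 144 by norm_num)
    filter_upwards [h1, Filter.eventually_ge_atTop 2] with n hn h2
    have h2' : (2 : ℝ) ≤ n := by exact_mod_cast h2
    simp only [Function.comp_apply, id_eq, Real.norm_eq_abs] at hn
    rw [abs_of_nonneg (by linarith : (0 : ℝ) ≤ n)] at hn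
    have := le_abs_self (Real.log n)
    linarith
  obtain ⟨N, hN⟩ := Filter.eventually_atTop.1 hev
  -- Below `N`, a saving of one is a fraction of at least `1 / (N.choose 2 + 1)`.
  refine ⟨min (1 / 6) (1 / (N.choose 2 + 1)), by positivity, fun n hn => ?_⟩
  have hn6 : (6 : ℝ) ≤ n := by exact_mod_cast hn
  have hch : (0 : ℝ) ≤ n.choose 2 := by positivity
  rcases le_or_gt N n with h | h
  · have h1 := U_le_log n (by omega)
    have h2 := hN n h
    have h3 : (U n : ℝ) ≤ (1 - 1 / 6) * (n.choose 2 : ℝ) := by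
      rw [Nat.cast_choose_two] at h1 ⊢
      nlinarith
    refine h3.trans (mul_le_mul_of_nonneg_right ?_ hch)
    linarith [min_le_left (1 / 6 : ℝ) (1 / (N.choose 2 + 1))]
  · obtain ⟨l, hl, hs⟩ := exists_hasShuffle_lt_choose n hn
    have h1 : (U n : ℝ) + 1 ≤ n.choose 2 := by exact_mod_cast (Nat.add_le_add_right hs.le 1).trans hl
    have h2 : (n.choose 2 : ℝ) ≤ N.choose 2 := by exact_mod_cast Nat.choose_le_choose 2 h.le
    have h3 : min (1 / 6 : ℝ) (1 / (N.choose 2 + 1)) * n.choose 2 ≤ 1 := by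
      refine (mul_le_mul_of_nonneg_right (min_le_right _ _) hch).trans ?_
      rw [one_div_mul_eq_div, div_le_one (by positivity)]
      linarith
    linarith

end Lengths

/-- The first conjunct says that the minimum defining `U n` is attained, so that the bounds below
are about lengths of transposition shuffles that exist. -/
theorem theorem1 :
    (∀ n : ℕ, IsLeast (shuffleLengths n) (U n)) ∧
    (∃ ε : ℝ, 0 < ε ∧ ∀ n : ℕ, 6 ≤ n → (U n : ℝ) ≤ (1 - ε) * (n.choose 2 : ℝ)) ∧
    (∃ C : ℝ, ∀ n : ℕ, 1 ≤ n →
      (U n : ℝ) ≤ 2 / 3 * (n.choose 2 : ℝ) + C * ((n : ℝ) * Real.log (n : ℝ))) :=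
  ⟨fun n => ⟨Nat.sInf_mem ⟨_, (hasShuffle_choose n).mem⟩, fun _ hl => Nat.sInf_le hl⟩,
    exists_U_le_one_sub_mul_choose, 6, U_le_log⟩
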